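/- **Notation.** For a $p\times p$ real matrix $M=(m_{ij})$ let $\operatorname{offdiag}(M)$ be $M$ with its diagonal entries replaced by $0$, and for $r>0$ let $\ell_r(M)=\max_{i\le p}\sum_{j\le p}|m_{ij}|^r$. For $q\ge 0$ and $R>0$ let $$\mathcal G_q(R)=\Bigl\{\Sigma \text{ symmetric positive semi-definite } p\times p:\ \max_{i\le p}\sum_{j\le p}|\sigma_{ij}|^q\le R,\ \sigma_{ii}=1 \text{ for all } i\Bigr\},$$ with the convention $0^0=0$. Given a sample of $n\ge 1$ independent copies of a random vector $X$ in $\mathbb R^p$, consider the testing problem $$H_0:\ X\sim\mathcal N(0,I_p),\qquad H_1:\ X\sim\mathcal N\bigl(0,I_p+\kappa\cdot\operatorname{offdiag}(\Sigma)\bigr),\quad \Sigma\in\bigcup_{q'\in[0,r)}\bigl\{\Sigma\in\mathcal G_{q'}(R):\ \ell_r(\operatorname{offdiag}(\Sigma))=1\bigr\},$$ where only those $\Sigma$ are considered for which $I_p+\kappa\cdot\operatorname{offdiag}(\Sigma)$ is positive semi-definite (all of them if $0\le\kappa\le1$). For a test $\psi$, that is, a measurable $\{0,1\}$-valued function of the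 sample, let $\mathbb P_{H_0}(\psi=1)$ be its probability of type I error and let $\mathbb P_{H_1}(\psi=0)$ be the largest (supremum) probability of type II error over the composite alternative. **Theorem.** There is a continuous function $\nu\mapsto C_\nu$ from $(0,\infty)$ to $(0,\infty)$ with $C_\nu\to 1/2$ as $\nu\to0$ such that the following holds for all $\nu>0$, all integers $n,p$ with $n\ge1$, and all real $q,r,R$ with $0\le q<r\le 2$, $R>2$, $R^2n^q<\nu p$ and $R^2n^q<p$ (the last condition follows from the one before it if $\nu\le1$). Put $$\underline\kappa=R^{1/r}\Bigl(\frac{\log\bigl(\nu p/(R^2n^q)\bigr)}{2n}\Bigr)^{(r-q)/(2r)}>0 .$$ Then for every $\kappa$ with $0\le\kappa<\underline\kappa$ and $2\kappa^2\le (Rn^{q/2})^{(2-r)/r}$ (the latter holds automatically if $r\le1$ and $\kappa\le1$), $$\inf_\psi\bigl\{\mathbb P_{H_0}(\psi=1)\vee\mathbb P_{H_1}(\psi=0)\bigr\}\ \ge\ C_\nu ,$$ where the infimum is over all tests. -/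

import Mathlib

open MeasureTheory ProbabilityTheory Filter Topology Set
open scoped ENNReal

noncomputable section

namespace CorrDetect

/-- The number `|x| ^ q`, with the sparsity convention that it is `0` at `x = 0` for every `q`
(also for `q = 0`, where the sum of these numbers counts the nonzero entries). -/
def absPow (q x : ℝ) : ℝ := if x = 0 then 0 else |x| ^ q

/-- The operator that sets to `0` all the diagonal entries of a square matrix. -/
def offdiag {p : ℕ} (M : Matrix (Fin p) (Fin p) ℝ) : Matrix (Fin p) (Fin p) ℝ :=
  Matrix.of fun i j => if i = j then 0 else M i j

/-- The functional `ℓ_r(M) = max_i ∑_j |m_ij| ^ r`. -/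
def ell {p : ℕ} (r : ℝ) (M : Matrix (Fin p) (Fin p) ℝ) : ℝ :=
  ⨆ i : Fin p, ∑ j : Fin p, absPow r (M i j)

/-- The class `G_q(R)` of `p × p` correlation matrices all of whose rows (the diagonal entry
included) satisfy `∑_j |σ_ij| ^ q ≤ R`. -/
def classG (p : ℕ) (q R : ℝ) : Set (Matrix (Fin p) (Fin p) ℝ) :=
  {S | S.PosSemidef ∧ (∀ i, ∑ j : Fin p, absPow q (S i j) ≤ R) ∧ ∀ i, S i i = 1}

/-- The covariance matrix `I_p + κ · offdiag(S)`. -/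
def altCov {p : ℕ} (κ : ℝ) (S : Matrix (Fin p) (Fin p) ℝ) : Matrix (Fin p) (Fin p) ℝ :=
  1 + κ • offdiag S

/-- The parameter set of the alternative: the union over `q ∈ [0, r)` of the sets
`{S ∈ G_q(R) : ℓ_r(offdiag S) = 1}`. Only those `S` count for which `I_p + κ · offdiag(S)` is a
covariance matrix at all, which is no restriction when `0 ≤ κ ≤ 1`. -/
def altSet (p : ℕ) (r R κ : ℝ) : Set (Matrix (Fin p) (Fin p) ℝ) :=
  {S | (∃ q, 0 ≤ q ∧ q < r ∧ S ∈ classG p q R) ∧ ell r (offdiag S) = 1 ∧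
    (altCov κ S).PosSemidef}

/-- The law of a sample of `n` independent random vectors with distribution `N(0, S)`. -/
def sampleLaw (n : ℕ) {p : ℕ} (S : Matrix (Fin p) (Fin p) ℝ) :
    Measure (Fin n → EuclideanSpace ℝ (Fin p)) :=
  Measure.pi fun _ => multivariateGaussian 0 S

/-- The error of the test `ψ` (`true` means that the null hypothesis is rejected): the maximum of
the probability of error under the null hypothesis `N(0, I_p)` and of the largest probability of
error over the composite alternative. -/
def testError {n p : ℕ} (r R κ : ℝ) (ψ : (Fin n → EuclideanSpace ℝ (Fin p)) → Bool) : ℝ≥0∞ :=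
  max (sampleLaw n (1 : Matrix (Fin p) (Fin p) ℝ) {x | ψ x = true})
    (⨆ S ∈ altSet p r R κ, sampleLaw n (altCov κ S) {x | ψ x = false})

/-- The infimum of the error over all measurable tests based on `n` observations in
dimension `p`. -/
def minimaxError (n p : ℕ) (r R κ : ℝ) : ℝ≥0∞ :=
  ⨅ (ψ : (Fin n → EuclideanSpace ℝ (Fin p)) → Bool) (_ : Measurable ψ), testError r R κ ψ

/-- The detection threshold
`R ^ (1/r) * (log (ν p / (R² n ^ q)) / (2 n)) ^ ((r - q) / (2 r))`. -/
def kappaLow (n p : ℕ) (q r R ν : ℝ) : ℝ :=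
  R ^ (1 / r) *
    (Real.log (ν * p / (R ^ 2 * (n : ℝ) ^ q)) / (2 * n)) ^ ((r - q) / (2 * r))

end CorrDetect

end

open MeasureTheory ProbabilityTheory Filter Topology Set
open scoped ENNReal

noncomputable section

/-! The proof is the chi-square (second moment) method. If the likelihood ratio `L` of a uniform
mixture of alternatives satisfies `E L² ≤ 1 + x` under the null, Cauchy–Schwarz keeps every test's
maximal error above `errorBound x`, which tends to `1/2` as `x → 0`.

The alternatives are stars: one center correlated with `k` leaves, every correlation equal to
`k^(-1/r)`, so that `ℓ_r` is exactly 1. Put `K = R n^(q/2)` and `k = ⌈K⌉`. The center is fixed, and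
one leaf is drawn from each of `k` disjoint blocks of `m ≈ p/k` coordinates.

With edge covariance `t = κ k^(-1/r)`, two stars sharing `N` leaves have likelihood ratios whose
product has mean `(1 - t² N)^(-n) ≤ E^N`, where `E = exp(2nt²)` (`det_starCov`,
`inv_sqrt_det_pow_le`). Under the prior `N` is binomial with parameters `k` and `1/m`, so the
average of `E^N` is at most `exp(kE/m)` (`sum_pow_card_filter_le`).

Below the threshold `2nt² ≤ max(2, log(νp/K²))` (`two_mul_sq_le_of_lt_kappaLow`). Hence `kE/m`,
which is of order `K²E/p`, is at most `48ν`, and `x = exp(48ν) - 1` works. -/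

namespace CorrDetect

/-! ### Gaussian likelihood ratios and their second moments -/

section Densities

variable {ι : Type*} [Fintype ι]

/-- A product of measures with densities has the product density. -/
theorem pi_withDensity_ofReal {E : ι → Type*} [∀ i, MeasurableSpace (E i)]
    (μ : ∀ i, Measure (E i)) [∀ i, SigmaFinite (μ i)] (f : ∀ i, E i → ℝ)
    (hf : ∀ i, Integrable (f i) (μ i)) (h0 : ∀ i x, 0 ≤ f i x) :
    Measure.pi (fun i => (μ i).withDensity fun x => ENNReal.ofReal (f i x)) =
      (Measure.pi μ).withDensity fun x => ENNReal.ofReal (∏ i, f i (x i)) := by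
  have hfin : ∀ i, IsFiniteMeasure ((μ i).withDensity fun x => ENNReal.ofReal (f i x)) :=
    fun i => isFiniteMeasure_withDensity_ofReal (hf i).2
  refine Measure.pi_eq fun s hs => ?_
  rw [withDensity_apply _ (MeasurableSet.univ_pi hs), ← lintegral_indicator
    (MeasurableSet.univ_pi hs)]
  have hind : ∀ x : ∀ i, E i, (univ.pi s).indicator
      (fun x => ENNReal.ofReal (∏ i, f i (x i))) x =
      ENNReal.ofReal (∏ i, (s i).indicator (f i) (x i)) := by
    intro x
    by_cases hx : x ∈ univ.pi s
    · rw [indicator_of_mem hx]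
      congr 1
      exact Finset.prod_congr rfl fun i _ => (indicator_of_mem (hx i (mem_univ i)) _).symm
    · rw [indicator_of_notMem hx]
      have : ∃ i, x i ∉ s i := by simpa [Set.mem_pi] using hx
      obtain ⟨i, hi⟩ := this
      rw [Finset.prod_eq_zero (Finset.mem_univ i) (indicator_of_notMem hi _), ENNReal.ofReal_zero]
  have hint : ∀ i, Integrable ((s i).indicator (f i)) (μ i) := fun i => (hf i).indicator (hs i)
  have hnn : ∀ i x, 0 ≤ (s i).indicator (f i) x := fun i x =>
    indicator_nonneg (fun y _ => h0 i y) x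
  simp_rw [hind]
  rw [← ofReal_integral_eq_lintegral_ofReal (Integrable.fintype_prod_dep hint)
    (Eventually.of_forall fun x => Finset.prod_nonneg fun i _ => hnn i _),
    integral_fintype_prod_eq_prod, ENNReal.ofReal_prod_of_nonneg
      fun i _ => integral_nonneg (hnn i)]
  refine Finset.prod_congr rfl fun i _ => ?_
  rw [withDensity_apply _ (hs i), integral_indicator (hs i),
    ofReal_integral_eq_lintegral_ofReal (hf i).restrict (Eventually.of_forall (h0 i))]

theorem map_withDensity_comp {α β : Type*} [MeasurableSpace α] [MeasurableSpace β]
    (μ : Measure α) {T : α → β} (hT : Measurable T) {f : β → ℝ≥0∞} (hf : Measurable f) :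
    (μ.withDensity fun x => f (T x)).map T = (μ.map T).withDensity f := by
  ext s hs
  rw [Measure.map_apply hT hs, withDensity_apply _ (hT hs), withDensity_apply _ hs,
    setLIntegral_map hs hf hT]

/-- The Lebesgue density of the standard Gaussian distribution. -/
def stdDensity (x : EuclideanSpace ℝ ι) : ℝ :=
  (√(2 * Real.pi))⁻¹ ^ Fintype.card ι * Real.exp (-(x.ofLp ⬝ᵥ x.ofLp) / 2)

theorem measurable_stdDensity : Measurable (stdDensity (ι := ι)) := by
  unfold stdDensity dotProduct
  fun_prop

theorem stdDensity_pos (x : EuclideanSpace ℝ ι) : 0 < stdDensity x := by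
  unfold stdDensity; positivity

theorem stdGaussian_eq_withDensity :
    stdGaussian (EuclideanSpace ℝ ι) = volume.withDensity fun x => ENNReal.ofReal (stdDensity x) := by
  rw [← map_pi_eq_stdGaussian, gaussianReal_of_var_ne_zero 0 one_ne_zero]
  unfold gaussianPDF
  rw [pi_withDensity_ofReal (fun _ : ι => (volume : Measure ℝ)) (fun _ => gaussianPDFReal 0 1)
    (fun _ => integrable_gaussianPDFReal 0 1) (fun _ x => gaussianPDFReal_nonneg 0 1 x)]
  have h : ∀ x : ι → ℝ, ∏ i, gaussianPDFReal 0 1 (x i) = stdDensity (WithLp.toLp 2 x) := by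
    intro x
    simp only [gaussianPDFReal, stdDensity, Finset.prod_mul_distrib, ← Real.exp_sum]
    simp [dotProduct, ← Finset.sum_div, pow_two, Finset.sum_neg_distrib]
  simp_rw [h]
  rw [map_withDensity_comp _ (by fun_prop) (f := fun x => ENNReal.ofReal (stdDensity x))
    measurable_stdDensity.ennreal_ofReal]
  congr 1
  exact (PiLp.volume_preserving_toLp ι).map_eq

variable [DecidableEq ι]

/-- The likelihood ratio of `N(0, S)` with respect to `N(0, I)`. -/
def gaussLik (S : Matrix ι ι ℝ) (x : EuclideanSpace ℝ ι) : ℝ :=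
  (√S.det)⁻¹ * Real.exp (-(x.ofLp ⬝ᵥ S⁻¹.mulVec x.ofLp - x.ofLp ⬝ᵥ x.ofLp) / 2)

theorem measurable_gaussLik (S : Matrix ι ι ℝ) : Measurable (gaussLik S) := by
  unfold gaussLik dotProduct Matrix.mulVec dotProduct
  fun_prop

theorem gaussLik_nonneg (S : Matrix ι ι ℝ) (x : EuclideanSpace ℝ ι) : 0 ≤ gaussLik S x := by
  unfold gaussLik; positivity

theorem det_toEuclideanCLM (R : Matrix ι ι ℝ) :
    LinearMap.det (Matrix.toEuclideanCLM (𝕜 := ℝ) R : EuclideanSpace ℝ ι →ₗ[ℝ] _) = R.det := by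
  rw [Matrix.coe_toEuclideanCLM_eq_toEuclideanLin, Matrix.toEuclideanLin, Matrix.toLpLin_eq_toLin,
    LinearMap.det_toLin]

-- `N(0, S)` is the image of the standard Gaussian under the square root of `S`. A linear change of
-- variables gives its Lebesgue density, which is then divided by the standard one.
open scoped MatrixOrder in
theorem multivariateGaussian_eq_withDensity {S : Matrix ι ι ℝ} (hS : S.PosDef) :
    multivariateGaussian 0 S =
      (stdGaussian (EuclideanSpace ℝ ι)).withDensity fun x => ENNReal.ofReal (gaussLik S x) := by
  set R := CFC.sqrt S with hR
  have hRR : R * R = S := CFC.sqrt_mul_sqrt_self _ hS.posSemidef.nonneg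
  have hRs : R.IsHermitian := (CFC.sqrt_nonneg S).isSelfAdjoint
  have hdS : 0 < S.det := hS.det_pos
  have hdet : R.det * R.det = S.det := by rw [← Matrix.det_mul, hRR]
  have hR0 : R.det ≠ 0 := fun h => by simp [h] at hdet; exact hdS.ne hdet
  have hRu : IsUnit R.det := isUnit_iff_ne_zero.2 hR0
  have habs : |R.det| = √S.det := by rw [← hdet, Real.sqrt_mul_self_eq_abs]
  set T : EuclideanSpace ℝ ι →L[ℝ] EuclideanSpace ℝ ι := Matrix.toEuclideanCLM (𝕜 := ℝ) R
  set T' : EuclideanSpace ℝ ι →L[ℝ] EuclideanSpace ℝ ι := Matrix.toEuclideanCLM (𝕜 := ℝ) R⁻¹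
  have hTT : ∀ x, T' (T x) = x := by
    intro x
    rw [← ContinuousLinearMap.comp_apply, ← ContinuousLinearMap.mul_def, ← map_mul,
      Matrix.nonsing_inv_mul _ hRu, map_one, one_apply_eq_self]
  have hm : Measurable fun y => ENNReal.ofReal (stdDensity (T' y)) :=
    (measurable_stdDensity.comp T'.continuous.measurable).ennreal_ofReal
  have hdT : LinearMap.det (T : EuclideanSpace ℝ ι →ₗ[ℝ] _) = R.det := det_toEuclideanCLM R
  have hvol : (volume : Measure (EuclideanSpace ℝ ι)).map T =
      ENNReal.ofReal |R.det⁻¹| • volume := by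
    have := Measure.map_linearMap_addHaar_eq_smul_addHaar (volume : Measure (EuclideanSpace ℝ ι))
      (f := (T : EuclideanSpace ℝ ι →ₗ[ℝ] _)) (by rwa [hdT])
    rwa [hdT] at this
  have hleft : multivariateGaussian 0 S = volume.withDensity fun y =>
      ENNReal.ofReal (|R.det⁻¹| * stdDensity (T' y)) := by
    have : (fun x => (0 : EuclideanSpace ℝ ι) + T x) = T := by ext1 x; simp
    rw [multivariateGaussian, this, stdGaussian_eq_withDensity]
    have h2 : (fun x : EuclideanSpace ℝ ι => ENNReal.ofReal (stdDensity x)) =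
        fun x => ENNReal.ofReal (stdDensity (T' (T x))) := by simp_rw [hTT]
    rw [h2, map_withDensity_comp _ T.continuous.measurable hm, hvol, withDensity_smul_measure,
      ← withDensity_smul _ hm]
    congr 1
    ext1 y
    simp [ENNReal.ofReal_mul]
  rw [hleft, stdGaussian_eq_withDensity, ← withDensity_mul _ measurable_stdDensity.ennreal_ofReal
    (measurable_gaussLik S).ennreal_ofReal]
  congr 1
  ext1 y
  rw [Pi.mul_apply, ← ENNReal.ofReal_mul (stdDensity_pos y).le]
  congr 1
  have hq : (T' y).ofLp ⬝ᵥ (T' y).ofLp = y.ofLp ⬝ᵥ S⁻¹.mulVec y.ofLp := by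
    have hT' : (T' y).ofLp = R⁻¹.mulVec y.ofLp := rfl
    have hsymm : (R⁻¹).transpose = R⁻¹ := by
      rw [Matrix.transpose_nonsing_inv]; congr 1
    rw [hT', ← hRR, Matrix.mul_inv_rev, ← Matrix.mulVec_mulVec, Matrix.dotProduct_mulVec y.ofLp,
      ← Matrix.mulVec_transpose, hsymm]
  unfold stdDensity gaussLik
  rw [hq, abs_inv, habs, mul_mul_mul_comm, ← Real.exp_add]
  rw [mul_left_comm, ← mul_assoc]
  congr 2
  ring

/-- The exponents add up to that of a centered Gaussian with precision `S⁻¹ + T⁻¹ - 1`. The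
remaining constant comes from `S (S⁻¹ + T⁻¹ - 1) T = S + T - S T`. -/
theorem gaussLik_mul_gaussLik {S T : Matrix ι ι ℝ} (hS : S.PosDef) (hT : T.PosDef)
    (hM : (S⁻¹ + T⁻¹ - 1).PosDef) (x : EuclideanSpace ℝ ι) :
    gaussLik S x * gaussLik T x =
      (√(S + T - S * T).det)⁻¹ * gaussLik (S⁻¹ + T⁻¹ - 1)⁻¹ x := by
  have hSu : IsUnit S.det := hS.det_pos.ne'.isUnit
  have hTu : IsUnit T.det := hT.det_pos.ne'.isUnit
  have hMu : IsUnit (S⁻¹ + T⁻¹ - 1).det := hM.det_pos.ne'.isUnit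
  have hmat : S * (S⁻¹ + T⁻¹ - 1) * T = S + T - S * T := by
    rw [mul_sub, mul_add, Matrix.mul_nonsing_inv _ hSu, mul_one, sub_mul, add_mul, one_mul,
      mul_assoc, Matrix.nonsing_inv_mul _ hTu, mul_one, add_comm]
  have hdet : (S + T - S * T).det = S.det * T.det * (S⁻¹ + T⁻¹ - 1).det := by
    rw [← hmat, Matrix.det_mul, Matrix.det_mul]; ring
  unfold gaussLik
  rw [Matrix.nonsing_inv_nonsing_inv _ hMu, mul_mul_mul_comm, ← Real.exp_add, ← mul_assoc]
  congr 1
  · rw [hdet, Real.sqrt_mul (mul_pos hS.det_pos hT.det_pos).le, Real.sqrt_mul hS.det_pos.le,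
      Matrix.det_nonsing_inv, Ring.inverse_eq_inv', Real.sqrt_inv, inv_inv]
    have := (Real.sqrt_pos.2 hM.det_pos).ne'
    field_simp
  · congr 1
    rw [Matrix.sub_mulVec, Matrix.add_mulVec, Matrix.one_mulVec, dotProduct_sub, dotProduct_add]
    ring

theorem lintegral_gaussLik {S : Matrix ι ι ℝ} (hS : S.PosDef) :
    ∫⁻ x, ENNReal.ofReal (gaussLik S x) ∂stdGaussian (EuclideanSpace ℝ ι) = 1 := by
  have h : multivariateGaussian 0 S univ = 1 := measure_univ
  rwa [multivariateGaussian_eq_withDensity hS, withDensity_apply _ MeasurableSet.univ,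
    Measure.restrict_univ] at h

theorem integrable_gaussLik {S : Matrix ι ι ℝ} (hS : S.PosDef) :
    Integrable (gaussLik S) (stdGaussian (EuclideanSpace ℝ ι)) := by
  refine (lintegral_ofReal_ne_top_iff_integrable (measurable_gaussLik S).aestronglyMeasurable
    (Eventually.of_forall (gaussLik_nonneg S))).1 ?_
  rw [lintegral_gaussLik hS]; exact ENNReal.one_ne_top

theorem integral_gaussLik {S : Matrix ι ι ℝ} (hS : S.PosDef) :
    ∫ x, gaussLik S x ∂stdGaussian (EuclideanSpace ℝ ι) = 1 := by
  rw [integral_eq_lintegral_of_nonneg_ae (Eventually.of_forall (gaussLik_nonneg S))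
    (measurable_gaussLik S).aestronglyMeasurable, lintegral_gaussLik hS, ENNReal.toReal_one]

theorem integrable_gaussLik_mul {S T : Matrix ι ι ℝ} (hS : S.PosDef) (hT : T.PosDef)
    (hM : (S⁻¹ + T⁻¹ - 1).PosDef) :
    Integrable (fun x => gaussLik S x * gaussLik T x) (stdGaussian (EuclideanSpace ℝ ι)) := by
  simp_rw [gaussLik_mul_gaussLik hS hT hM]
  exact (integrable_gaussLik hM.inv).const_mul _

theorem integral_gaussLik_mul {S T : Matrix ι ι ℝ} (hS : S.PosDef) (hT : T.PosDef)
    (hM : (S⁻¹ + T⁻¹ - 1).PosDef) :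
    ∫ x, gaussLik S x * gaussLik T x ∂stdGaussian (EuclideanSpace ℝ ι) =
      (√(S + T - S * T).det)⁻¹ := by
  simp_rw [gaussLik_mul_gaussLik hS hT hM]
  rw [integral_const_mul, integral_gaussLik hM.inv, mul_one]

/-- Two covariance matrices below `2 I` have square integrable likelihood ratios. -/
theorem posDef_inv_add_inv_sub_one {S T : Matrix ι ι ℝ} (hS : S.PosDef) (hT : T.PosDef)
    (hS2 : (1 - (S - 1) * (S - 1)).PosDef) (hT2 : (1 - (T - 1) * (T - 1)).PosDef) :
    (S⁻¹ + T⁻¹ - 1).PosDef := by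
  have key : ∀ {S : Matrix ι ι ℝ}, S.PosDef → (1 - (S - 1) * (S - 1)).PosDef →
      (S⁻¹ - (2⁻¹ : ℝ) • 1).PosDef := by
    intro S hS hS2
    have hu : IsUnit S.det := hS.det_pos.ne'.isUnit
    -- Since `1 - (S - 1)² = 2S - S²`, conjugating by `S⁻¹` and halving leaves `S⁻¹ - 1/2`.
    have h := (hS2.conjTranspose_mul_mul_same (B := S⁻¹)
      (Matrix.mulVec_injective_of_isUnit hS.inv.isUnit)).smul (a := (2⁻¹ : ℝ)) (by norm_num)
    rw [hS.inv.isHermitian] at h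
    convert h using 1
    have : 1 - (S - 1) * (S - 1) = (2 : ℝ) • S - S * S := by rw [two_smul]; noncomm_ring
    rw [this, mul_sub, sub_mul, mul_smul_comm, Matrix.nonsing_inv_mul _ hu, ← mul_assoc,
      Matrix.nonsing_inv_mul _ hu, one_mul, Matrix.mul_nonsing_inv _ hu, smul_mul_assoc, one_mul,
      smul_sub, smul_smul]
    norm_num
  have := (key hS hS2).add (key hT hT2)
  convert this using 1
  have h1 : (1 : Matrix ι ι ℝ) = (2⁻¹ : ℝ) • 1 + (2⁻¹ : ℝ) • 1 := by
    rw [← add_smul]; norm_num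
  nth_rw 1 [h1]
  abel

end Densities

/-! ### From the second moment to the error of a test -/

section Testing

/-- If the chi-square divergence of an alternative from the null hypothesis is at most `x`, then
every test has maximal error at least `errorBound x`. -/
def errorBound (x : ℝ) : ℝ := 1 / 2 * (1 - √(x / (4 + x)))

/-- With `d = (1 - 2e)²` one has `e(1 - e) = (1 - d)/4`, so the inequality solves to `d ≤ x/(4 +
x)`. -/
theorem errorBound_le_of_sq_le {x e : ℝ} (hx : 0 ≤ x)
    (h : e < 1 / 2 → (1 - 2 * e) ^ 2 ≤ x * (e * (1 - e))) : errorBound x ≤ e := by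
  unfold errorBound
  have hs := Real.sqrt_nonneg (x / (4 + x))
  rcases lt_or_ge e (1 / 2) with he | he
  · have h1 : 1 - 2 * e ≤ √(x / (4 + x)) := by
      apply Real.le_sqrt_of_sq_le
      rw [le_div_iff₀ (by linarith)]
      nlinarith [h he]
    linarith
  · linarith

variable {Ω : Type*} [MeasurableSpace Ω] {P : Measure Ω} [IsProbabilityMeasure P]

/-- This is Cauchy–Schwarz for `L - 1` and the centered indicator of `A`. It is obtained from the
discriminant of the nonnegative quadratic `s ↦ E(L - 1 - s(1_A - P(A)))²`, with its constant term
raised to `x`. -/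
theorem sq_le_of_integral_sq_le {L : Ω → ℝ} (hL : Integrable L P)
    (hL2 : Integrable (fun ω => L ω ^ 2) P) (h1 : ∫ ω, L ω ∂P = 1) {x : ℝ}
    (hx : ∫ ω, L ω ^ 2 ∂P ≤ 1 + x) {A : Set Ω} (hA : MeasurableSet A) :
    (∫ ω in A, L ω ∂P - P.real A) ^ 2 ≤ x * (P.real A * (1 - P.real A)) := by
  set a := P.real A with ha
  set c := ∫ ω in A, L ω ∂P with hc
  have hI : Integrable (A.indicator fun _ => (1 : ℝ)) P := (integrable_const 1).indicator hA
  have hLI : Integrable (A.indicator L) P := hL.indicator hA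
  have hIa : ∫ ω, A.indicator (fun _ => (1 : ℝ)) ω ∂P = a := by
    rw [integral_indicator hA]; simp [ha]
  have hLIc : ∫ ω, A.indicator L ω ∂P = c := integral_indicator hA
  have key : ∀ s : ℝ, 0 ≤ (a * (1 - a)) * (s * s) + (-2 * (c - a)) * s + x := by
    intro s
    have h0 : 0 ≤ ∫ ω, (L ω - 1 - s * (A.indicator (fun _ => (1 : ℝ)) ω - a)) ^ 2 ∂P :=
      integral_nonneg fun ω => sq_nonneg _
    have hexp : ∀ ω, (L ω - 1 - s * (A.indicator (fun _ => (1 : ℝ)) ω - a)) ^ 2 =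
        L ω ^ 2 + (-2 + 2 * s * a) * L ω + (-2 * s) * A.indicator L ω +
          (s ^ 2 * (1 - 2 * a) + 2 * s) * A.indicator (fun _ => (1 : ℝ)) ω +
          (1 + s ^ 2 * a ^ 2 - 2 * s * a) := by
      intro ω
      by_cases hω : ω ∈ A
      · simp only [indicator_of_mem hω]; ring
      · simp only [indicator_of_notMem hω]; ring
    have e1 : Integrable (fun ω => L ω ^ 2 + (-2 + 2 * s * a) * L ω) P :=
      hL2.add (hL.const_mul _)
    have e2 : Integrable (fun ω => L ω ^ 2 + (-2 + 2 * s * a) * L ω +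
        (-2 * s) * A.indicator L ω) P := e1.add (hLI.const_mul _)
    have e3 : Integrable (fun ω => L ω ^ 2 + (-2 + 2 * s * a) * L ω +
        (-2 * s) * A.indicator L ω +
        (s ^ 2 * (1 - 2 * a) + 2 * s) * A.indicator (fun _ => (1 : ℝ)) ω) P :=
      e2.add (hI.const_mul _)
    simp_rw [hexp] at h0
    rw [integral_add e3 (integrable_const _), integral_add e2 (hI.const_mul _),
      integral_add e1 (hLI.const_mul _), integral_add hL2 (hL.const_mul _), integral_const_mul,
      integral_const_mul, integral_const_mul, hIa, hLIc, h1] at h0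
    simp only [integral_const, probReal_univ, smul_eq_mul, one_mul] at h0
    nlinarith
  have := discrim_le_zero key
  unfold discrim at this
  nlinarith

/-- Lower bound for the error of a test through the second moment of a mixture of likelihood
ratios. -/
theorem errorBound_le_of_mixture {G : Type*} [Fintype G] [Nonempty G] {F : G → Ω → ℝ}
    (hF : ∀ g, Integrable (F g) P) (hF2 : ∀ g h, Integrable (fun ω => F g ω * F h ω) P)
    (h1 : ∀ g, ∫ ω, F g ω ∂P = 1) {x : ℝ} (hx0 : 0 ≤ x)
    (hx : ∀ g, ∑ h, ∫ ω, F g ω * F h ω ∂P ≤ (1 + x) * Fintype.card G)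
    {A : Set Ω} (hA : MeasurableSet A) {e : ℝ} (he : P.real A ≤ e)
    (he' : ∀ g, ∫ ω in Aᶜ, F g ω ∂P ≤ e) : errorBound x ≤ e := by
  set N : ℝ := (Fintype.card G : ℝ) with hN
  have hN0 : 0 < N := by rw [hN]; exact_mod_cast Fintype.card_pos
  set L : Ω → ℝ := fun ω => N⁻¹ * ∑ g, F g ω with hLdef
  have hL : Integrable L P := (integrable_finsetSum _ fun g _ => hF g).const_mul _
  have hsq : ∀ ω, L ω ^ 2 = (N⁻¹) ^ 2 * ∑ g, ∑ h, F g ω * F h ω := by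
    intro ω
    rw [hLdef, mul_pow, pow_two (∑ g, F g ω), Finset.sum_mul_sum]
  have hL2 : Integrable (fun ω => L ω ^ 2) P := by
    simp_rw [hsq]
    exact (integrable_finsetSum _ fun g _ => integrable_finsetSum _ fun h _ => hF2 g h).const_mul _
  have hL1 : ∫ ω, L ω ∂P = 1 := by
    rw [hLdef, integral_const_mul, integral_finsetSum _ fun g _ => hF g]
    simp [h1, ← hN, hN0.ne']
  have hM : ∫ ω, L ω ^ 2 ∂P ≤ 1 + x := by
    simp_rw [hsq]
    rw [integral_const_mul, integral_finsetSum _ fun g _ =>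
      integrable_finsetSum _ fun h _ => hF2 g h]
    simp_rw [integral_finsetSum _ fun h _ => hF2 _ h]
    calc (N⁻¹) ^ 2 * ∑ g, ∑ h, ∫ ω, F g ω * F h ω ∂P
        ≤ (N⁻¹) ^ 2 * ∑ _g : G, (1 + x) * N := by gcongr with g; exact hx g
      _ = 1 + x := by
        rw [Finset.sum_const, Finset.card_univ, nsmul_eq_mul, ← hN]; field_simp
  have hb : ∫ ω in Aᶜ, L ω ∂P ≤ e := by
    rw [hLdef, integral_const_mul, integral_finsetSum _ fun g _ => (hF g).integrableOn]
    calc N⁻¹ * ∑ g, ∫ ω in Aᶜ, F g ω ∂P ≤ N⁻¹ * ∑ _g : G, e := by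
          gcongr with g; exact he' g
      _ = e := by rw [Finset.sum_const, Finset.card_univ, nsmul_eq_mul, ← hN]; field_simp
  have hsum := integral_add_compl hA hL
  rw [hL1] at hsum
  have hCS := sq_le_of_integral_sq_le hL hL2 hL1 hM hA
  have ha0 : 0 ≤ P.real A := measureReal_nonneg
  refine errorBound_le_of_sq_le hx0 fun hlt => ?_
  have hd : 1 - 2 * e ≤ ∫ ω in A, L ω ∂P - P.real A := by linarith
  calc (1 - 2 * e) ^ 2 ≤ (∫ ω in A, L ω ∂P - P.real A) ^ 2 :=
        pow_le_pow_left₀ (by linarith) hd 2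
    _ ≤ x * (P.real A * (1 - P.real A)) := hCS
    -- The function `a ↦ a(1 - a)` increases on `[0, 1/2]`, and `P(A) ≤ e < 1/2`.
    _ ≤ x * (e * (1 - e)) := mul_le_mul_of_nonneg_left (by nlinarith) hx0

end Testing

/-! ### Likelihood ratios of samples and the chi-square bound -/

section Samples

variable {n p : ℕ}

/-- The likelihood ratio of a sample from `N(0, S)`. -/
def sampleLik (n : ℕ) (S : Matrix (Fin p) (Fin p) ℝ) (x : Fin n → EuclideanSpace ℝ (Fin p)) : ℝ :=
  ∏ i, gaussLik S (x i)

instance (S : Matrix (Fin p) (Fin p) ℝ) : IsProbabilityMeasure (sampleLaw n S) := by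
  unfold sampleLaw; infer_instance

theorem sampleLik_nonneg (S : Matrix (Fin p) (Fin p) ℝ) (x : Fin n → EuclideanSpace ℝ (Fin p)) :
    0 ≤ sampleLik n S x := Finset.prod_nonneg fun i _ => gaussLik_nonneg S (x i)

theorem sampleLaw_one : sampleLaw n (1 : Matrix (Fin p) (Fin p) ℝ) =
    Measure.pi fun _ => stdGaussian (EuclideanSpace ℝ (Fin p)) := by
  simp [sampleLaw]

theorem sampleLaw_eq_withDensity {S : Matrix (Fin p) (Fin p) ℝ} (hS : S.PosDef) :
    sampleLaw n S = (sampleLaw n (1 : Matrix (Fin p) (Fin p) ℝ)).withDensity fun x =>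
      ENNReal.ofReal (sampleLik n S x) := by
  rw [sampleLaw_one, sampleLaw, multivariateGaussian_eq_withDensity hS]
  exact pi_withDensity_ofReal _ (fun _ => gaussLik S) (fun _ => integrable_gaussLik hS)
    (fun _ x => gaussLik_nonneg S x)

theorem integrable_sampleLik {S : Matrix (Fin p) (Fin p) ℝ} (hS : S.PosDef) :
    Integrable (sampleLik n S) (sampleLaw n 1) := by
  rw [sampleLaw_one]
  exact Integrable.fintype_prod_dep fun _ => integrable_gaussLik hS

theorem integral_sampleLik {S : Matrix (Fin p) (Fin p) ℝ} (hS : S.PosDef) :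
    ∫ x, sampleLik n S x ∂sampleLaw n 1 = 1 := by
  rw [sampleLaw_one]
  unfold sampleLik
  rw [integral_fintype_prod_eq_prod (fun _ => gaussLik S)]
  simp [integral_gaussLik hS]

theorem setIntegral_sampleLik {S : Matrix (Fin p) (Fin p) ℝ} (hS : S.PosDef)
    {A : Set (Fin n → EuclideanSpace ℝ (Fin p))} (hA : MeasurableSet A) :
    ∫ x in A, sampleLik n S x ∂sampleLaw n 1 = (sampleLaw n S).real A := by
  rw [Measure.real, sampleLaw_eq_withDensity hS, withDensity_apply _ hA,
    integral_eq_lintegral_of_nonneg_ae (Eventually.of_forall (sampleLik_nonneg S))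
      (integrable_sampleLik hS).integrableOn.aestronglyMeasurable]

variable {S T : Matrix (Fin p) (Fin p) ℝ}

theorem integrable_sampleLik_mul (hS : S.PosDef) (hT : T.PosDef)
    (hM : (S⁻¹ + T⁻¹ - 1).PosDef) :
    Integrable (fun x => sampleLik n S x * sampleLik n T x) (sampleLaw n 1) := by
  rw [sampleLaw_one]
  simp_rw [sampleLik, ← Finset.prod_mul_distrib]
  exact Integrable.fintype_prod_dep (f := fun _ x => gaussLik S x * gaussLik T x)
    fun _ => integrable_gaussLik_mul hS hT hM

theorem integral_sampleLik_mul (hS : S.PosDef) (hT : T.PosDef)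
    (hM : (S⁻¹ + T⁻¹ - 1).PosDef) :
    ∫ x, sampleLik n S x * sampleLik n T x ∂sampleLaw n 1 =
      (√(S + T - S * T).det)⁻¹ ^ n := by
  rw [sampleLaw_one]
  simp_rw [sampleLik, ← Finset.prod_mul_distrib]
  rw [integral_fintype_prod_eq_prod (fun _ x => gaussLik S x * gaussLik T x)]
  simp [integral_gaussLik_mul hS hT hM]

/-- The chi-square method for the detection problem: `G` indexes a uniform prior on the
alternative. -/
theorem errorBound_le_minimaxError {r R κ : ℝ} {G : Type*} [Fintype G] [Nonempty G]
    {S : G → Matrix (Fin p) (Fin p) ℝ} (hS : ∀ g, S g ∈ altSet p r R κ)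
    (hpd : ∀ g, (altCov κ (S g)).PosDef)
    (hM : ∀ g h, ((altCov κ (S g))⁻¹ + (altCov κ (S h))⁻¹ - 1).PosDef) {x : ℝ} (hx0 : 0 ≤ x)
    (hx : ∀ g, ∑ h, (√(altCov κ (S g) + altCov κ (S h) -
      altCov κ (S g) * altCov κ (S h)).det)⁻¹ ^ n ≤ (1 + x) * Fintype.card G) :
    ENNReal.ofReal (errorBound x) ≤ minimaxError n p r R κ := by
  refine le_iInf₂ fun ψ hψ => ?_
  by_cases htop : testError r R κ ψ = ⊤
  · rw [htop]; exact le_top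
  rw [ENNReal.ofReal_le_iff_le_toReal htop]
  have hA : MeasurableSet {x | ψ x = true} := hψ (measurableSet_singleton true)
  refine errorBound_le_of_mixture (P := sampleLaw n 1) (F := fun g => sampleLik n (altCov κ (S g)))
    (fun g => integrable_sampleLik (hpd g))
    (fun g h => integrable_sampleLik_mul (hpd g) (hpd h) (hM g h))
    (fun g => integral_sampleLik (hpd g)) hx0 (fun g => ?_) hA ?_ fun g => ?_
  · simp_rw [integral_sampleLik_mul (hpd g) (hpd _) (hM g _)]
    exact hx g
  · exact ENNReal.toReal_mono htop (le_max_left _ _)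
  · rw [setIntegral_sampleLik (hpd g) hA.compl]
    refine ENNReal.toReal_mono htop ((?_ : _ ≤ _).trans (le_max_right _ _))
    have : {x | ψ x = true}ᶜ = {x | ψ x = false} := by ext x; simp
    rw [this]
    exact le_iSup₂ (f := fun S _ => sampleLaw n (altCov κ S) {x | ψ x = false}) (S g) (hS g)

end Samples

/-! ### Covariance matrices supported on stars -/

section Star

open Matrix

variable {p : ℕ}

/-- The indicator vector of a set of coordinates. -/
def indVec (s : Finset (Fin p)) : Fin p → ℝ := fun i => if i ∈ s then 1 else 0

/-- The adjacency matrix of the star with center `c` and set of leaves `s`. -/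
def starAdj (c : Fin p) (s : Finset (Fin p)) : Matrix (Fin p) (Fin p) ℝ :=
  vecMulVec (Pi.single c 1) (indVec s) + vecMulVec (indVec s) (Pi.single c 1)

/-- The covariance matrix with covariance `t` along the edges of a star. -/
def starCov (t : ℝ) (c : Fin p) (s : Finset (Fin p)) : Matrix (Fin p) (Fin p) ℝ :=
  1 + t • starAdj c s

variable {c : Fin p} {s s' : Finset (Fin p)} {t : ℝ}

theorem starAdj_apply (i j : Fin p) : starAdj c s i j =
    (if i = c then 1 else 0) * (if j ∈ s then 1 else 0) +
      (if i ∈ s then 1 else 0) * (if j = c then 1 else 0) := by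
  simp [starAdj, vecMulVec_apply, indVec, Pi.single_apply]

theorem isHermitian_starAdj : (starAdj c s).IsHermitian := by
  ext i j
  simp only [conjTranspose_apply, starAdj_apply, star_trivial]
  ring

theorem starAdj_self (hc : c ∉ s) (i : Fin p) : starAdj c s i i = 0 := by
  rw [starAdj_apply]
  by_cases hi : i = c
  · subst hi; simp [hc]
  · simp [hi]

theorem indVec_dotProduct (x : Fin p → ℝ) : indVec s ⬝ᵥ x = ∑ i ∈ s, x i := by
  simp [indVec, dotProduct, Finset.sum_ite_mem]

theorem indVec_dotProduct_indVec : indVec s ⬝ᵥ indVec s' = ((s ∩ s').card : ℝ) := by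
  rw [indVec_dotProduct]; simp [indVec, Finset.sum_ite_mem]

theorem dotProduct_starAdj_mulVec (x : Fin p → ℝ) :
    x ⬝ᵥ starAdj c s *ᵥ x = 2 * x c * ∑ i ∈ s, x i := by
  rw [starAdj, add_mulVec, vecMulVec_mulVec, vecMulVec_mulVec, dotProduct_add, indVec_dotProduct]
  simp [dotProduct_smul, dotProduct_comm x (indVec s), indVec_dotProduct]
  ring

/-- The mixed terms vanish because the center is not a leaf. What remains is one rank-one piece at
the center and one on the leaves. -/
theorem starAdj_mul_starAdj (hc : c ∉ s) (hc' : c ∉ s') :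
    starAdj c s * starAdj c s' = ((s ∩ s').card : ℝ) • vecMulVec (Pi.single c 1) (Pi.single c 1) +
      vecMulVec (indVec s) (indVec s') := by
  rw [starAdj, starAdj, add_mul, mul_add, mul_add]
  simp only [vecMulVec_mul_vecMulVec, indVec_dotProduct_indVec]
  simp [indVec, hc, hc', vecMulVec_smul]

theorem sq_add_sum_sq_le (hc : c ∉ s) (x : Fin p → ℝ) :
    x c ^ 2 + ∑ i ∈ s, x i ^ 2 ≤ x ⬝ᵥ x := by
  rw [← Finset.sum_insert hc (f := fun i => x i ^ 2)]
  simp only [dotProduct, ← pow_two]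
  exact Finset.sum_le_univ_sum_of_nonneg fun i => sq_nonneg _

/-- With `σ` the sum of `x` over the leaves, Cauchy–Schwarz gives `t²σ² ≤ ∑ x_i²`, so the quadratic
form is at least `(x_c + tσ)²`. -/
theorem posSemidef_starCov (hc : c ∉ s) (ht : t ^ 2 * s.card ≤ 1) : (starCov t c s).PosSemidef := by
  refine PosSemidef.of_dotProduct_mulVec_nonneg
    (isHermitian_one.add (isHermitian_starAdj.smul (IsSelfAdjoint.all t))) fun x => ?_
  rw [star_trivial, starCov, add_mulVec, one_mulVec, smul_mulVec, dotProduct_add,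
    dotProduct_smul, dotProduct_starAdj_mulVec, smul_eq_mul]
  have h1 := sq_add_sum_sq_le hc x
  have h2 : (∑ i ∈ s, x i) ^ 2 ≤ s.card * ∑ i ∈ s, x i ^ 2 := sq_sum_le_card_mul_sum_sq
  have h3 : 0 ≤ ∑ i ∈ s, x i ^ 2 := Finset.sum_nonneg fun i _ => sq_nonneg _
  have h4 : t ^ 2 * (∑ i ∈ s, x i) ^ 2 ≤ ∑ i ∈ s, x i ^ 2 := by
    calc _ ≤ t ^ 2 * (s.card * ∑ i ∈ s, x i ^ 2) := by gcongr
      _ = t ^ 2 * s.card * ∑ i ∈ s, x i ^ 2 := by ring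
      _ ≤ 1 * ∑ i ∈ s, x i ^ 2 := by gcongr
      _ = _ := one_mul _
  nlinarith [sq_nonneg (x c + t * ∑ i ∈ s, x i)]

theorem starCov_sub_one : starCov t c s - 1 = t • starAdj c s := by
  rw [starCov, add_sub_cancel_left]

theorem posDef_one_sub_sq_starCov (hc : c ∉ s) (ht : t ^ 2 * s.card ≤ 1 / 2) :
    (1 - (starCov t c s - 1) * (starCov t c s - 1)).PosDef := by
  have hH : (t • starAdj c s).IsHermitian := isHermitian_starAdj.smul (IsSelfAdjoint.all t)
  rw [starCov_sub_one]
  refine PosDef.of_dotProduct_mulVec_pos (isHermitian_one.sub ?_) fun x hx => ?_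
  · have := isHermitian_conjTranspose_mul_self (t • starAdj c s)
    rwa [hH] at this
  rw [smul_mul_smul_comm, starAdj_mul_starAdj hc hc, star_trivial, sub_mulVec, one_mulVec,
    smul_mulVec, add_mulVec, smul_mulVec, vecMulVec_mulVec, vecMulVec_mulVec, dotProduct_sub,
    dotProduct_smul, dotProduct_add, indVec_dotProduct, Finset.inter_self]
  simp only [dotProduct_smul, op_smul_eq_mul, smul_eq_mul, single_dotProduct,
    dotProduct_single, one_mul, mul_one, dotProduct_comm x (indVec s), indVec_dotProduct]
  have h1 := sq_add_sum_sq_le hc x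
  have h2 : (∑ i ∈ s, x i) ^ 2 ≤ s.card * ∑ i ∈ s, x i ^ 2 := sq_sum_le_card_mul_sum_sq
  have h3 : 0 ≤ ∑ i ∈ s, x i ^ 2 := Finset.sum_nonneg fun i _ => sq_nonneg _
  have h0 : 0 < x ⬝ᵥ x := by
    have := dotProduct_star_self_pos_iff.2 hx
    simpa using this
  have h4 : t ^ 2 * (s.card * x c ^ 2 + (∑ i ∈ s, x i) ^ 2) ≤ 1 / 2 * (x ⬝ᵥ x) := by
    calc _ ≤ t ^ 2 * (s.card * x c ^ 2 + s.card * ∑ i ∈ s, x i ^ 2) := by gcongr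
      _ = t ^ 2 * s.card * (x c ^ 2 + ∑ i ∈ s, x i ^ 2) := by ring
      _ ≤ 1 / 2 * (x ⬝ᵥ x) := by gcongr
  nlinarith

/-- A singular `S` would make `1 - (S - 1)² = (2 - S) S` singular too. -/
theorem posDef_starCov (hc : c ∉ s) (ht : t ^ 2 * s.card ≤ 1 / 2) : (starCov t c s).PosDef := by
  refine (posSemidef_starCov hc (by linarith)).posDef_iff_det_ne_zero.2 fun h0 => ?_
  have h := (posDef_one_sub_sq_starCov hc ht).det_pos
  have hf : 1 - (starCov t c s - 1) * (starCov t c s - 1) =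
      (1 - (starCov t c s - 1)) * starCov t c s := by noncomm_ring
  rw [hf, det_mul, h0, mul_zero] at h
  exact h.false

theorem det_one_sub_vecMulVec (a b : Fin p → ℝ) : (1 - vecMulVec a b).det = 1 - b ⬝ᵥ a := by
  have := det_one_add_replicateCol_mul_replicateRow (ι := Unit) (-a) b
  rw [sub_eq_add_neg, ← neg_vecMulVec, vecMulVec_eq Unit, this, dotProduct_neg, sub_eq_add_neg]

/-- The matrix is `1 - (S - 1)(T - 1)`, which splits into commuting center and leaf factors. Each is
a rank-one perturbation of the identity with determinant `1 - t²N`, where `N` is the number of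
common leaves. The result is a perfect square, so the root in the likelihood formula disappears. -/
theorem det_starCov (hc : c ∉ s) (hc' : c ∉ s') :
    (starCov t c s + starCov t c s' - starCov t c s * starCov t c s').det =
      (1 - t ^ 2 * (s ∩ s').card) ^ 2 := by
  have h1 : starCov t c s + starCov t c s' - starCov t c s * starCov t c s' =
      1 - (starCov t c s - 1) * (starCov t c s' - 1) := by noncomm_ring
  have hvu : indVec s' ⬝ᵥ indVec s = ((s ∩ s').card : ℝ) := by
    rw [dotProduct_comm, indVec_dotProduct_indVec]
  have h2 : 1 - (starCov t c s - 1) * (starCov t c s' - 1) =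
      (1 - vecMulVec ((t ^ 2 * (s ∩ s').card) • Pi.single c 1) (Pi.single c 1)) *
        (1 - vecMulVec (t ^ 2 • indVec s) (indVec s')) := by
    rw [starCov_sub_one, starCov_sub_one, smul_mul_smul_comm, starAdj_mul_starAdj hc hc', sub_mul,
      mul_sub, mul_sub, vecMulVec_mul_vecMulVec]
    simp [indVec, hc, smul_vecMulVec, smul_smul, pow_two]
    abel
  rw [h1, h2, det_mul, det_one_sub_vecMulVec, det_one_sub_vecMulVec, dotProduct_smul,
    dotProduct_smul, hvu]
  simp
  ring

theorem inv_sqrt_det_pow_le (hc : c ∉ s) (hc' : c ∉ s') (ht : t ^ 2 * s.card ≤ 1 / 2) (n : ℕ) :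
    (√(starCov t c s + starCov t c s' - starCov t c s * starCov t c s').det)⁻¹ ^ n ≤
      Real.exp (2 * n * t ^ 2) ^ (s ∩ s').card := by
  set y := t ^ 2 * ((s ∩ s').card : ℝ) with hy
  have hy0 : 0 ≤ y := by positivity
  have hy2 : y ≤ 1 / 2 := by
    refine le_trans ?_ ht
    rw [hy]
    gcongr
    exact Finset.inter_subset_left
  rw [det_starCov hc hc', Real.sqrt_sq (by linarith)]
  -- Here `y ≤ 1/2` is essential: it gives `(1 - y)⁻¹ ≤ 1 + 2y`.
  have h1 : (1 - y)⁻¹ ≤ Real.exp (2 * y) := by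
    have h2 : (1 - y)⁻¹ ≤ 1 + 2 * y := by
      rw [inv_le_iff_one_le_mul₀ (by linarith)]; nlinarith
    linarith [Real.add_one_le_exp (2 * y)]
  calc (1 - y)⁻¹ ^ n ≤ Real.exp (2 * y) ^ n :=
        pow_le_pow_left₀ (inv_nonneg.2 (by linarith)) h1 n
    _ = Real.exp (2 * n * t ^ 2) ^ (s ∩ s').card := by
      rw [← Real.exp_nat_mul, ← Real.exp_nat_mul, hy]; congr 1; ring

theorem offdiag_starCov (hc : c ∉ s) : offdiag (starCov t c s) = t • starAdj c s := by
  ext i j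
  by_cases hij : i = j
  · subst hij; simp [offdiag, starAdj_self hc]
  · simp [offdiag, starCov, hij]

theorem altCov_starCov (hc : c ∉ s) (κ : ℝ) : altCov κ (starCov t c s) = starCov (κ * t) c s := by
  rw [altCov, offdiag_starCov hc, smul_smul, starCov]

theorem sum_absPow_offdiag_starCov (hc : c ∉ s) (ht : 0 < t) (q : ℝ) (i : Fin p) :
    ∑ j, absPow q (offdiag (starCov t c s) i j) =
      if i = c then s.card * t ^ q else if i ∈ s then t ^ q else 0 := by
  rw [offdiag_starCov hc]
  simp only [Matrix.smul_apply, starAdj_apply, smul_eq_mul]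
  by_cases hi : i = c
  · have his : i ∉ s := hi ▸ hc
    simp only [hi, hc, if_true, if_false, one_mul, zero_mul, add_zero]
    have : ∀ j, absPow q (t * if j ∈ s then 1 else 0) = if j ∈ s then t ^ q else 0 := by
      intro j
      split_ifs
      · simp [absPow, ht.ne', abs_of_pos ht]
      · simp [absPow]
    simp only [this, Finset.sum_ite_mem, Finset.univ_inter, Finset.sum_const, nsmul_eq_mul]
  · simp only [hi, if_false, zero_mul, zero_add]
    by_cases his : i ∈ s
    · simp only [his, if_true, one_mul]
      have : ∀ j, absPow q (t * if j = c then 1 else 0) = if j = c then t ^ q else 0 := by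
        intro j
        split_ifs
        · simp [absPow, ht.ne', abs_of_pos ht]
        · simp [absPow]
      simp only [this, Finset.sum_ite_eq', Finset.mem_univ, if_true]
    · simp [his, absPow]

theorem sum_absPow_of_diag_one {M : Matrix (Fin p) (Fin p) ℝ} (hM : ∀ i, M i i = 1) (q : ℝ)
    (i : Fin p) : ∑ j, absPow q (M i j) = 1 + ∑ j, absPow q (offdiag M i j) := by
  rw [← Finset.add_sum_erase _ _ (Finset.mem_univ i),
    ← Finset.add_sum_erase _ (fun j => absPow q (offdiag M i j)) (Finset.mem_univ i)]
  have h0 : offdiag M i i = 0 := by simp [offdiag]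
  have h1 : ∀ j ∈ Finset.univ.erase i, absPow q (offdiag M i j) = absPow q (M i j) := by
    intro j hj
    rw [offdiag, of_apply, if_neg (Finset.ne_of_mem_erase hj).symm]
  rw [h0, hM, Finset.sum_congr rfl h1]
  simp [absPow]

/-- A star with `k` leaves and correlations `k ^ (-1/r)` lies in the alternative. -/
theorem starCov_mem_altSet (hc : c ∉ s) (hs : 0 < s.card) {r R κ : ℝ} (hr : 0 < r) (hr2 : r ≤ 2)
    (hR : 2 < R) (hκ : (κ * (s.card : ℝ) ^ (-1 / r)) ^ 2 * s.card ≤ 1 / 2) :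
    starCov ((s.card : ℝ) ^ (-1 / r)) c s ∈ altSet p r R κ := by
  set k : ℝ := (s.card : ℝ) with hk
  have hk1 : 1 ≤ k := by rw [hk]; exact_mod_cast hs
  have hk0 : 0 < k := by linarith
  set ρ := k ^ (-1 / r) with hρ
  have hρ0 : 0 < ρ := Real.rpow_pos_of_pos hk0 _
  have hρq : ∀ q : ℝ, ρ ^ q = k ^ (-q / r) := by
    intro q; rw [hρ, ← Real.rpow_mul hk0.le]; congr 1; ring
  have hρ1 : ∀ q : ℝ, 0 ≤ q → ρ ^ q ≤ 1 := fun q hq => by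
    rw [hρq]; exact Real.rpow_le_one_of_one_le_of_nonpos hk1
      (div_nonpos_of_nonpos_of_nonneg (by linarith) hr.le)
  have hkr : k * ρ ^ r = 1 := by
    rw [hρq, neg_div, div_self hr.ne', Real.rpow_neg_one, mul_inv_cancel₀ hk0.ne']
  have hdiag : ∀ i, starCov ρ c s i i = 1 := fun i => by
    simp [starCov, starAdj_self hc]
  have hpsd : ρ ^ 2 * k ≤ 1 := by
    rw [← Real.rpow_natCast, hρq, ← Real.rpow_add_one hk0.ne']
    refine Real.rpow_le_one_of_one_le_of_nonpos hk1 ?_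
    have : 1 ≤ 2 / r := by rw [le_div_iff₀ hr]; linarith
    push_cast
    rw [neg_div]; linarith
  refine ⟨?_, ?_, ?_⟩
  -- The sparsity index is chosen just below `r`, independently of the `q` in the threshold. The
  -- center row sums to `1 + k^(1 - q/r)`, which tends to 2 as `q ↑ r`, so `R > 2` suffices for
  -- every `k`.
  · have hcont : Tendsto (fun q : ℝ => k ^ (1 - q / r)) (𝓝[<] r) (𝓝 1) := by
      have : ContinuousAt (fun q : ℝ => k ^ (1 - q / r)) r :=
        ContinuousAt.rpow continuousAt_const (by fun_prop) (Or.inl hk0.ne')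
      have h2 := this.tendsto
      rw [div_self hr.ne', sub_self, Real.rpow_zero] at h2
      exact h2.mono_left nhdsWithin_le_nhds
    have hev : ∀ᶠ q in 𝓝[<] r, k ^ (1 - q / r) < R - 1 :=
      hcont.eventually_lt_const (by linarith)
    have hev2 : ∀ᶠ q in 𝓝[<] r, q ∈ Ioo 0 r := Ioo_mem_nhdsLT hr
    obtain ⟨q, hq1, hq2⟩ := (hev.and hev2).exists
    refine ⟨q, hq2.1.le, hq2.2, posSemidef_starCov hc hpsd, fun i => ?_, hdiag⟩
    rw [sum_absPow_of_diag_one hdiag, sum_absPow_offdiag_starCov hc hρ0]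
    split_ifs
    · have : k * ρ ^ q = k ^ (1 - q / r) := by
        rw [hρq, mul_comm, ← Real.rpow_add_one hk0.ne']; congr 1; ring
      rw [← hk, this]; linarith
    · linarith [hρ1 q hq2.1.le]
    · linarith
  · have hle : ∀ i, ∑ j, absPow r (offdiag (starCov ρ c s) i j) ≤ 1 := by
      intro i
      rw [sum_absPow_offdiag_starCov hc hρ0]
      split_ifs
      · exact hkr.le
      · exact hρ1 r hr.le
      · exact zero_le_one
    have : Nonempty (Fin p) := ⟨c⟩
    refine le_antisymm (ciSup_le hle) ?_
    refine le_ciSup_of_le ⟨1, by rintro _ ⟨i, rfl⟩; exact hle i⟩ c ?_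
    rw [sum_absPow_offdiag_starCov hc hρ0, if_pos rfl]
    exact hkr.ge
  · rw [altCov_starCov hc]
    exact posSemidef_starCov hc (by rw [← hk]; linarith)

end Star

/-! ### The uniform prior on leaves and the law of the overlap -/

section Prior

variable {k m p : ℕ}

/-- The leaves chosen by `g`: one out of `m` in each of `k` disjoint blocks of coordinates. -/
def leaves (e : Option (Fin k × Fin m) ↪ Fin p) (g : Fin k → Fin m) : Finset (Fin p) :=
  Finset.univ.image fun i => e (some (i, g i))

variable (e : Option (Fin k × Fin m) ↪ Fin p) (g h : Fin k → Fin m)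

theorem injective_leaf : Function.Injective fun i => e (some (i, g i)) := by
  intro i j hij
  simpa using congrArg Prod.fst (Option.some_injective _ (e.injective hij))

theorem none_notMem_leaves : e none ∉ leaves e g := by
  simp [leaves]

theorem card_leaves : (leaves e g).card = k := by
  rw [leaves, Finset.card_image_of_injective _ (injective_leaf e g), Finset.card_univ,
    Fintype.card_fin]

theorem card_leaves_inter :
    (leaves e g ∩ leaves e h).card = (Finset.univ.filter fun i => g i = h i).card := by
  rw [← Finset.card_image_of_injective (Finset.univ.filter fun i => g i = h i)
    (injective_leaf e g)]
  congr 1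
  ext x
  simp only [leaves, Finset.mem_inter, Finset.mem_image, Finset.mem_univ, true_and,
    Finset.mem_filter]
  constructor
  · rintro ⟨⟨i, rfl⟩, j, hj⟩
    have := Option.some_injective _ (e.injective hj)
    obtain ⟨rfl, h2⟩ := Prod.mk.inj this
    exact ⟨j, h2.symm, rfl⟩
  · rintro ⟨i, hi, rfl⟩
    exact ⟨⟨i, rfl⟩, i, by rw [hi]⟩

/-- The sum factorises over the blocks. In each block one choice agrees with `g` and contributes
`E`, while the other `m - 1` contribute 1. -/
theorem sum_pow_card_filter_eq (E : ℝ) :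
    ∑ h : Fin k → Fin m, E ^ (Finset.univ.filter fun i => g i = h i).card =
      (E + (m - 1)) ^ k := by
  have h1 : ∀ h : Fin k → Fin m, E ^ (Finset.univ.filter fun i => g i = h i).card =
      ∏ i, if g i = h i then E else 1 := by
    intro h
    rw [Finset.prod_ite, Finset.prod_const, Finset.prod_const_one, mul_one]
  have h2 : ∀ a : Fin m, ∑ b, (if a = b then E else 1) = E + (m - 1) := by
    intro a
    have : ∀ b, (if a = b then E else 1) = (if a = b then E - 1 else 0) + 1 := by
      intro b; split_ifs <;> ring
    simp only [this, Finset.sum_add_distrib, Finset.sum_ite_eq, Finset.mem_univ, if_true,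
      Finset.sum_const, Finset.card_univ, Fintype.card_fin, nsmul_eq_mul, mul_one]
    ring
  simp_rw [h1]
  rw [← Fintype.piFinset_univ, ← Finset.prod_univ_sum (fun _ => Finset.univ)
    (fun i b => if g i = b then E else 1)]
  simp [h2]

theorem sum_pow_card_filter_le (hm : 0 < m) {E y : ℝ} (hE : 1 ≤ E) (hy : k * E ≤ y * m) :
    ∑ h : Fin k → Fin m, E ^ (Finset.univ.filter fun i => g i = h i).card ≤
      Real.exp y * (m : ℝ) ^ k := by
  have hm0 : (0 : ℝ) < m := by exact_mod_cast hm
  rw [sum_pow_card_filter_eq]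
  have h1 : E + (m - 1) ≤ m * Real.exp (E / m) := by
    have := Real.add_one_le_exp (E / m)
    calc E + (m - 1) ≤ m * (E / m + 1) := by rw [mul_add, mul_div_cancel₀ _ hm0.ne']; linarith
      _ ≤ _ := by gcongr
  have h2 : k * (E / m) ≤ y := by rw [← mul_div_assoc, div_le_iff₀ hm0]; exact hy
  have h3 : (1 : ℝ) ≤ m := by exact_mod_cast hm
  calc (E + (m - 1)) ^ k ≤ (m * Real.exp (E / m)) ^ k :=
        pow_le_pow_left₀ (by linarith) h1 k
    _ = Real.exp (k * (E / m)) * (m : ℝ) ^ k := by rw [mul_pow, ← Real.exp_nat_mul, mul_comm]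
    _ ≤ _ := by gcongr

end Prior

/-! ### Calibration of the prior at the detection threshold -/

section Main

/-- The lower bound for the prior on stars with `k` leaves. -/
theorem errorBound_le_minimaxError_of_star {n p k m : ℕ} (hk : 0 < k) (hm : 0 < m)
    (hp : k * m + 1 ≤ p) {r R κ y : ℝ} (hr : 0 < r) (hr2 : r ≤ 2) (hR : 2 < R)
    (hκ : (κ * (k : ℝ) ^ (-1 / r)) ^ 2 * k ≤ 1 / 2)
    (hy : k * Real.exp (2 * n * (κ * (k : ℝ) ^ (-1 / r)) ^ 2) ≤ y * m) :
    ENNReal.ofReal (errorBound (Real.exp y - 1)) ≤ minimaxError n p r R κ := by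
  have hcard : Fintype.card (Option (Fin k × Fin m)) ≤ Fintype.card (Fin p) := by
    simpa using hp
  obtain ⟨e⟩ := Function.Embedding.nonempty_of_card_le hcard
  have : Nonempty (Fin m) := ⟨⟨0, hm⟩⟩
  set ρ := (k : ℝ) ^ (-1 / r) with hρ
  have hc : ∀ g, e none ∉ leaves e g := none_notMem_leaves e
  have hcov : ∀ g, altCov κ (starCov ρ (e none) (leaves e g)) =
      starCov (κ * ρ) (e none) (leaves e g) := fun g => altCov_starCov (hc g) κ
  have hκ' : ∀ g, (κ * ρ) ^ 2 * ((leaves e g).card : ℝ) ≤ 1 / 2 := fun g => by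
    rwa [card_leaves]
  have hpd : ∀ g, (starCov (κ * ρ) (e none) (leaves e g)).PosDef := fun g =>
    posDef_starCov (hc g) (hκ' g)
  have hE1 : (1 : ℝ) ≤ Real.exp (2 * n * (κ * ρ) ^ 2) := Real.one_le_exp (by positivity)
  have hy0 : 0 ≤ y := by
    have h1 : (0 : ℝ) < m := by exact_mod_cast hm
    have h2 : 0 ≤ y * m := le_trans (by positivity) hy
    exact nonneg_of_mul_nonneg_left h2 h1
  refine errorBound_le_minimaxError (G := Fin k → Fin m)
    (S := fun g => starCov ρ (e none) (leaves e g)) (fun g => ?_) (fun g => ?_) (fun g h => ?_)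
    (by linarith [Real.one_le_exp hy0]) fun g => ?_
  · have := starCov_mem_altSet (hc g) (by rwa [card_leaves]) hr hr2 hR (κ := κ)
      (by rw [card_leaves]; exact hκ)
    rwa [card_leaves] at this
  · rw [hcov]; exact hpd g
  · rw [hcov, hcov]
    exact posDef_inv_add_inv_sub_one (hpd g) (hpd h) (posDef_one_sub_sq_starCov (hc g) (hκ' g))
      (posDef_one_sub_sq_starCov (hc h) (hκ' h))
  · simp_rw [hcov]
    calc _ ≤ ∑ h : Fin k → Fin m, Real.exp (2 * n * (κ * ρ) ^ 2) ^
          (Finset.univ.filter fun i => g i = h i).card := by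
          refine Finset.sum_le_sum fun h _ => ?_
          rw [← card_leaves_inter e g h]
          exact inv_sqrt_det_pow_le (hc g) (hc h) (hκ' g) n
      _ ≤ Real.exp y * (m : ℝ) ^ k := sum_pow_card_filter_le g hm hE1 hy
      _ = _ := by simp

theorem errorBound_pos {x : ℝ} (hx : 0 ≤ x) : 0 < errorBound x := by
  unfold errorBound
  have : √(x / (4 + x)) < 1 := by
    rw [Real.sqrt_lt' one_pos, div_lt_iff₀ (by linarith)]; linarith
  linarith

theorem continuousAt_errorBound {x : ℝ} (hx : 0 ≤ x) : ContinuousAt errorBound x := by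
  unfold errorBound
  have h : ContinuousAt (fun x : ℝ => x / (4 + x)) x :=
    continuousAt_id.div (by fun_prop) (by linarith)
  exact continuousAt_const.mul (continuousAt_const.sub h.sqrt)

/-- A star with at least `R * n ^ (q / 2)` leaves keeps the edge covariance of order `n ^ (-1/2)`,
up to the logarithm in the threshold. -/
theorem two_mul_sq_le_of_lt_kappaLow {n p : ℕ} (hn : 0 < n) {q r R ν κ k : ℝ} (hq : 0 ≤ q)
    (hqr : q < r) (hR : 0 < R)
    (hL : 0 < Real.log (ν * p / (R ^ 2 * (n : ℝ) ^ q))) (hκ : 0 ≤ κ)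
    (hκl : κ < kappaLow n p q r R ν) (hk : R * (n : ℝ) ^ (q / 2) ≤ k) :
    2 * n * (κ * k ^ (-1 / r)) ^ 2 ≤ max 2 (Real.log (ν * p / (R ^ 2 * (n : ℝ) ^ q))) := by
  have hr : 0 < r := hq.trans_lt hqr
  set L := Real.log (ν * p / (R ^ 2 * (n : ℝ) ^ q)) with hLdef
  have hn0 : (0 : ℝ) < n := by exact_mod_cast hn
  have hK0 : 0 < R * (n : ℝ) ^ (q / 2) := by positivity
  have hneg : -1 / r ≤ 0 := div_nonpos_of_nonpos_of_nonneg (by norm_num) hr.le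
  have h1 : κ * k ^ (-1 / r) ≤ kappaLow n p q r R ν * (R * (n : ℝ) ^ (q / 2)) ^ (-1 / r) :=
    mul_le_mul hκl.le (Real.rpow_le_rpow_of_nonpos hK0 hk hneg) (by
      have := hK0.trans_le hk
      positivity) (hκ.trans hκl.le)
  have h0 : 0 ≤ κ * k ^ (-1 / r) := by
    have := hK0.trans_le hk
    positivity
  set a := 1 - q / r with ha
  have ha0 : 0 ≤ a := by
    rw [ha, sub_nonneg, div_le_one hr]; exact hqr.le
  have ha1 : a ≤ 1 := by
    have : 0 ≤ q / r := by positivity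
    linarith
  -- The powers of `R` cancel. Those of `n` have exponents `-a/2` and `-q/(2r)`, which add up to
  -- `-1/2`.
  have h2 : kappaLow n p q r R ν * (R * (n : ℝ) ^ (q / 2)) ^ (-1 / r) =
      (L / 2) ^ (a / 2) * (n : ℝ) ^ (-(1 / 2) : ℝ) := by
    have e1 : (r - q) / (2 * r) = a / 2 := by rw [ha]; field_simp
    have e2 : L / (2 * n) = L / 2 * (n : ℝ)⁻¹ := by field_simp
    rw [kappaLow, ← hLdef, e1, e2, Real.mul_rpow (by positivity) (by positivity),
      Real.mul_rpow hR.le (by positivity), ← Real.rpow_mul hn0.le, ← Real.rpow_neg_one (n : ℝ),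
      ← Real.rpow_mul hn0.le]
    have e3 : R ^ (1 / r) * R ^ (-1 / r) = 1 := by
      rw [← Real.rpow_add hR, ← add_div]; simp
    have e4 : (n : ℝ) ^ (-1 * (a / 2)) * (n : ℝ) ^ (q / 2 * (-1 / r)) =
        (n : ℝ) ^ (-(1 / 2) : ℝ) := by
      rw [← Real.rpow_add hn0]
      congr 1
      rw [ha]; field_simp; ring
    rw [← e4]
    linear_combination ((L / 2) ^ (a / 2) * (n : ℝ) ^ (-1 * (a / 2)) *
      (n : ℝ) ^ (q / 2 * (-1 / r))) * e3
  have h3 : ((L / 2) ^ (a / 2) * (n : ℝ) ^ (-(1 / 2) : ℝ)) ^ 2 = (L / 2) ^ a * (n : ℝ)⁻¹ := by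
    rw [mul_pow, ← Real.rpow_natCast, ← Real.rpow_natCast, ← Real.rpow_mul (by positivity),
      ← Real.rpow_mul hn0.le, ← Real.rpow_neg_one (n : ℝ)]
    congr 2 <;> push_cast <;> ring
  -- When `L/2 < 1` the power may exceed its base; the 1 in the maximum covers this case.
  have h4 : (L / 2) ^ a ≤ max 1 (L / 2) := by
    rcases le_total (L / 2) 1 with h | h
    · exact (Real.rpow_le_one (by positivity) h ha0).trans (le_max_left _ _)
    · exact (Real.rpow_le_self_of_one_le h ha1).trans (le_max_right _ _)
  calc 2 * n * (κ * k ^ (-1 / r)) ^ 2 ≤ 2 * n * ((L / 2) ^ a * (n : ℝ)⁻¹) := by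
        rw [← h3, ← h2]; gcongr
    _ = 2 * (L / 2) ^ a := by field_simp
    _ ≤ 2 * max 1 (L / 2) := by gcongr
    _ = max 2 L := by rw [mul_max_of_nonneg _ _ (by norm_num)]; congr 1 <;> ring

/-- The left side is `κ² k^(-(2 - r)/r)`. This exponent is nonpositive for `r ≤ 2`, so rounding `K`
up to `k` only helps. -/
theorem sq_mul_rpow_le {r κ K k : ℝ} (hr : 0 < r) (hr2 : r ≤ 2) (hK : 0 < K) (hk : K ≤ k)
    (h : 2 * κ ^ 2 ≤ K ^ ((2 - r) / r)) : (κ * k ^ (-1 / r)) ^ 2 * k ≤ 1 / 2 := by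
  have hk0 : 0 < k := hK.trans_le hk
  have e1 : (k ^ (-1 / r)) ^ 2 * k = k ^ (-((2 - r) / r)) := by
    rw [← Real.rpow_natCast, ← Real.rpow_mul hk0.le, ← Real.rpow_add_one hk0.ne']
    congr 1
    push_cast; field_simp; ring
  have hexp : 0 ≤ (2 - r) / r := div_nonneg (by linarith) hr.le
  have h1 : 0 < k ^ ((2 - r) / r) := Real.rpow_pos_of_pos hk0 _
  have h2 : K ^ ((2 - r) / r) ≤ k ^ ((2 - r) / r) := Real.rpow_le_rpow hK.le hk hexp
  rw [mul_pow, mul_assoc, e1, Real.rpow_neg hk0.le, ← div_eq_mul_inv, div_le_iff₀ h1]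
  linarith

/-- Every test has error at least `errorBound (exp (48 ν) - 1)` below the detection threshold. -/
theorem errorBound_exp_le_minimaxError {ν : ℝ} (hν : 0 < ν) {n p : ℕ} (hn : 0 < n) {q r R : ℝ}
    (hq : 0 ≤ q) (hqr : q < r) (hr2 : r ≤ 2) (hR : 2 < R)
    (hdom : R ^ 2 * (n : ℝ) ^ q < ν * p) (hdim : R ^ 2 * (n : ℝ) ^ q < p) {κ : ℝ} (hκ : 0 ≤ κ)
    (hκl : κ < kappaLow n p q r R ν)
    (hpd : 2 * κ ^ 2 ≤ (R * (n : ℝ) ^ (q / 2)) ^ ((2 - r) / r)) :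
    ENNReal.ofReal (errorBound (Real.exp (48 * ν) - 1)) ≤ minimaxError n p r R κ := by
  have hr : 0 < r := hq.trans_lt hqr
  have hn0 : (0 : ℝ) < n := by exact_mod_cast hn
  have hn1 : (1 : ℝ) ≤ n := by exact_mod_cast hn
  set K := R * (n : ℝ) ^ (q / 2) with hK
  have hK2 : R ^ 2 * (n : ℝ) ^ q = K ^ 2 := by
    rw [hK, mul_pow, ← Real.rpow_natCast ((n : ℝ) ^ (q / 2)), ← Real.rpow_mul hn0.le]
    congr 2; push_cast; ring
  have hK2' : 2 < K := by
    have : (1 : ℝ) ≤ (n : ℝ) ^ (q / 2) := Real.one_le_rpow hn1 (by positivity)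
    nlinarith
  have hL : 0 < Real.log (ν * p / (R ^ 2 * (n : ℝ) ^ q)) := by
    apply Real.log_pos
    rw [one_lt_div (by positivity)]; exact hdom
  set k := ⌈K⌉₊ with hkdef
  have hKk : K ≤ k := Nat.le_ceil K
  have hkK : (k : ℝ) < K + 1 := Nat.ceil_lt_add_one (by linarith)
  have hlam := two_mul_sq_le_of_lt_kappaLow hn hq hqr (by linarith) hL hκ hκl hKk
  rw [hK2] at hdom hdim hlam hL
  have hk0 : 0 < k := by
    have : (0 : ℝ) < k := by linarith
    exact_mod_cast this
  -- There is room for the center and `k` leaves: `k + 1 < K + 2 < K² < p`, since `K > 2`.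
  have hkp : k + 1 ≤ p := by
    have : ((k + 1 : ℕ) : ℝ) < (p : ℝ) := by push_cast; nlinarith
    exact_mod_cast this.le
  -- One coordinate is reserved for the center. As `m ≥ 1`, the blocks fill at least half of the
  -- others.
  set m := (p - 1) / k with hmdef
  have hm : 0 < m := Nat.div_pos (by omega) hk0
  have hkm : k * m ≤ p - 1 := Nat.mul_div_le _ _
  have hkm2 : p ≤ 2 * (k * m) + 1 := by
    have h1 : p - 1 < k * (m + 1) := Nat.lt_mul_div_succ _ hk0
    have h2 : k * (m + 1) = k * m + k := by ring
    have h3 : k ≤ k * m := Nat.le_mul_of_pos_right k hm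
    omega
  have hkm3 : (p : ℝ) ≤ 2 * (k * m) + 1 := by exact_mod_cast hkm2
  have hm0 : (0 : ℝ) < m := by exact_mod_cast hm
  have hp0 : (0 : ℝ) < p := lt_trans (by positivity) hdim
  -- The constant is `8/3 · 9/4`: `p > 4` absorbs the `+ 1` in `hkm3`, and `k < K + 1 < 3K/2`.
  have hratio : (k : ℝ) * p ≤ 6 * K ^ 2 * m := by
    have h4 : 3 * (p : ℝ) ≤ 8 * (k * m) := by
      have : (4 : ℝ) < p := by nlinarith
      linarith
    have h5 : (k : ℝ) ^ 2 ≤ 9 / 4 * K ^ 2 := by nlinarith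
    have hk0' : (0 : ℝ) < k := by exact_mod_cast hk0
    calc (k : ℝ) * p ≤ k * (8 / 3 * (k * m)) := by gcongr; linarith
      _ = 8 / 3 * k ^ 2 * m := by ring
      _ ≤ 8 / 3 * (9 / 4 * K ^ 2) * m := by gcongr
      _ = 6 * K ^ 2 * m := by ring
  have hexp2 : Real.exp 2 ≤ 8 := by
    have h6 : Real.exp 2 = Real.exp 1 ^ 2 := by rw [← Real.exp_nat_mul]; norm_num
    rw [h6]
    nlinarith [Real.exp_one_lt_d9, Real.exp_pos 1]
  -- If the exponent is at most 2, then `exp 2 ≤ 8` and `K² < νp` give the bound. Otherwise the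
  -- logarithm in the threshold gives it even without the factor 8.
  have hE : K ^ 2 * Real.exp (2 * n * (κ * (k : ℝ) ^ (-1 / r)) ^ 2) ≤ 8 * (ν * p) := by
    have hKp : 0 < K ^ 2 := by positivity
    rcases le_max_iff.1 hlam with h | h
    · calc _ ≤ K ^ 2 * 8 := by
            gcongr; exact (Real.exp_le_exp.2 h).trans hexp2
        _ ≤ _ := by linarith
    · have h7 : Real.exp (2 * n * (κ * (k : ℝ) ^ (-1 / r)) ^ 2) ≤ ν * p / K ^ 2 := by
        rw [← Real.exp_log (show 0 < ν * p / K ^ 2 by positivity)]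
        exact Real.exp_le_exp.2 h
      rw [le_div_iff₀ hKp] at h7
      have : 0 < ν * p := by positivity
      linarith
  refine errorBound_le_minimaxError_of_star hk0 hm (by omega) hr hr2 hR
    (sq_mul_rpow_le hr hr2 (by linarith) hKk hpd) ?_
  set E := Real.exp (2 * n * (κ * (k : ℝ) ^ (-1 / r)) ^ 2) with hEdef
  have hE0 : 0 < E := Real.exp_pos _
  -- Here `48 = 6 · 8`, from `hratio` and `hE`.
  have : (k * E) * p ≤ (48 * ν * m) * p := by
    calc (k * E) * p = (k * p) * E := by ring
      _ ≤ (6 * K ^ 2 * m) * E := by gcongr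
      _ = 6 * m * (K ^ 2 * E) := by ring
      _ ≤ 6 * m * (8 * (ν * p)) := by gcongr
      _ = _ := by ring
  exact le_of_mul_le_mul_right this hp0

end Main

end CorrDetect

end

/-- Lower bound for the detection of correlations. The constant depends on `ν` only.
`hdom` says that the logarithm in the threshold is positive; `hdim` follows from it when `ν ≤ 1`;
`hpd` holds automatically when `r ≤ 1` and `κ ≤ 1`; for `R < 2` the alternative is empty. -/
theorem theorem4p4 :
    ∃ C : ℝ → ℝ,
      ContinuousOn C (Set.Ioi 0) ∧ (∀ ν, 0 < ν → 0 < C ν) ∧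
      Filter.Tendsto C (nhdsWithin 0 (Set.Ioi 0)) (nhds (1 / 2)) ∧
      ∀ (ν : ℝ) (_ : 0 < ν) (n p : ℕ) (_ : 0 < n) (q r R : ℝ) (_ : 0 ≤ q) (_ : q < r)
        (_ : r ≤ 2) (_ : 2 < R)
        (_hdom : R ^ 2 * (n : ℝ) ^ q < ν * p)
        (_hdim : R ^ 2 * (n : ℝ) ^ q < p)
        (κ : ℝ) (_ : 0 ≤ κ) (_ : κ < CorrDetect.kappaLow n p q r R ν)
        (_hpd : 2 * κ ^ 2 ≤ (R * (n : ℝ) ^ (q / 2)) ^ ((2 - r) / r)),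
        ENNReal.ofReal (C ν) ≤ CorrDetect.minimaxError n p r R κ := by
  have hx : ∀ ν : ℝ, 0 ≤ ν → 0 ≤ Real.exp (48 * ν) - 1 := fun ν hν => by
    linarith [Real.one_le_exp (show 0 ≤ 48 * ν by positivity)]
  have hcont : ∀ ν : ℝ, 0 ≤ ν →
      ContinuousAt (fun ν => CorrDetect.errorBound (Real.exp (48 * ν) - 1)) ν := fun ν hν =>
    ContinuousAt.comp (f := fun ν : ℝ => Real.exp (48 * ν) - 1)
      (CorrDetect.continuousAt_errorBound (hx ν hν)) (by fun_prop)
  refine ⟨fun ν => CorrDetect.errorBound (Real.exp (48 * ν) - 1),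
    fun ν hν => (hcont ν (le_of_lt hν)).continuousWithinAt,
    fun ν hν => CorrDetect.errorBound_pos (hx ν hν.le), ?_, ?_⟩
  -- The formula for the constant is continuous at `ν = 0` as well, so the limit is its value there.
  · have h := (hcont 0 le_rfl).tendsto
    have h0 : CorrDetect.errorBound (Real.exp (48 * 0) - 1) = 1 / 2 := by
      simp [CorrDetect.errorBound]
    rw [h0] at h
    exact h.mono_left nhdsWithin_le_nhds
  · intro ν hν n p hn q r R hq hqr hr2 hR hdom hdim κ hκ hκl hpd
    exact CorrDetect.errorBound_exp_le_minimaxError hν hn hq hqr hr2 hR hdom hdim hκ hκl hpd
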